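/- Let $\mathbb K$ be a field, $V$ a vector space over $\mathbb K$ of finite dimension $n$, and $e\in\mathfrak{gl}(V)$ a nilpotent element. Write $\mathfrak z(e)=\{\varphi\in\mathfrak{gl}(V):\varphi e=e\varphi\}$ for its centraliser, a Lie algebra under the commutator bracket. For a finite-dimensional Lie algebra $\mathfrak q$ and $\alpha\in\mathfrak q^*$, let $\mathfrak q_\alpha=\{\xi\in\mathfrak q:\alpha([\xi,\eta])=0\text{ for all }\eta\in\mathfrak q\}$ be the stabiliser of $\alpha$ in the coadjoint representation, and let $\operatorname{ind}\mathfrak q=\min_{\alpha\in\mathfrak q^*}\dim\mathfrak q_\alpha$ be the index of $\mathfrak q$. There are generators $w_1,\dots,w_k\in V$ of Jordan blocks of $e$ of dimensions $d_1+1,\dots,d_k+1$ with $d_i\ge 0$; that is, $e^{d_i+1}w_i=0$ for every $i$ and the vectors $e^sw_i$ $(1\le i\le k,\ 0\le s\le d_i)$ form a basis of $V$. For any choice of such $k$, $d_i$ and $w_i$ the following holds. For $\varphi\in\mathfrak z(e)$ define $c_i^{j,s}(\varphi)\in\mathbb K$ by $$\varphi(w_i)=\sum_{j=1}^k\sum_{s=0}^{d_j}c_i^{j,s}(\varphi)\,e^sw_j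 ,$$ and for $1\le i\le k$, $0\le s\le d_i$ let $\xi_i^{i,s}\in\mathfrak z(e)$ be the element with $\xi_i^{i,s}(w_i)=e^sw_i$ and $\xi_i^{i,s}(w_t)=0$ for $t\ne i$. 1. (Theorem) Let $a_1,\dots,a_k\in\mathbb K$ be non-zero and pairwise distinct, and let $\alpha\in\mathfrak z(e)^*$ be given by $\alpha(\varphi)=\sum_{i=1}^k a_i\,c_i^{i,d_i}(\varphi)$. Then the stabiliser $\mathfrak z(e)_\alpha$ consists exactly of those $\varphi\in\mathfrak z(e)$ that map the space $\langle e^sw_i: 0\le s\le d_i\rangle$ of each Jordan block into itself, it is the linear span of the elements $\xi_i^{i,s}$ $(1\le i\le k,\ 0\le s\le d_i)$, and $\dim\mathfrak z(e)_\alpha=n$. 2. (Corollary) If $\mathbb K$ contains at least $k$ elements, then $\operatorname{ind}\mathfrak z(e)=n=\operatorname{rk}\mathfrak{gl}(V)$. Here the rank $\operatorname{rk}\mathfrak q$ of a finite-dimensional Lie algebra $\mathfrak q$ is the least $m$ for which the coefficient of $t^m$ in the characteristic polynomial $\det(t-\operatorname{ad}x)$ is not identically zero as a polynomial in the coordinates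 of $x\in\mathfrak q$. -/

import Mathlib

attribute [local instance 100] LieRing.ofAssociativeRing

noncomputable section

/-- The stabiliser of a covector `α` under the coadjoint representation of a Lie algebra `L`.
Since `(ad* ξ) α = -α ∘ ad ξ`, it consists of all `ξ` with `α ⁅ξ, η⁆ = 0` for every `η`. -/
def coadjointStabilizer {K L : Type*} [Field K] [LieRing L] [LieAlgebra K L]
    (α : Module.Dual K L) : LieSubalgebra K L where
  carrier := {ξ | ∀ η : L, α ⁅ξ, η⁆ = 0}
  add_mem' := by
    intro x y hx hy η
    rw [add_lie, map_add, hx η, hy η, add_zero]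
  zero_mem' := by
    intro η
    rw [zero_lie, map_zero]
  smul_mem' := by
    intro c x hx η
    rw [smul_lie, map_smul, hx η, smul_zero]
  lie_mem' := by
    intro x y hx hy η
    rw [lie_lie, map_sub, hx, hy, sub_zero]

/-- The index of a finite-dimensional Lie algebra: the minimum over all covectors `α` of the
dimension of the stabiliser of `α` (a minimum of a non-empty set of natural numbers). -/
def lieIndex (K L : Type*) [Field K] [LieRing L] [LieAlgebra K L] : ℕ :=
  ⨅ α : Module.Dual K L, Module.finrank K (coadjointStabilizer α)

/-- The centraliser `𝔷(e)` of `e` in `𝔤𝔩(V)`. The Lie bracket is the commutator. -/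
def glCentralizer {K V : Type*} [Field K] [AddCommGroup V] [Module K V]
    (e : Module.End K V) : LieSubalgebra K (Module.End K V) where
  carrier := {φ | φ * e = e * φ}
  add_mem' := by
    intro x y hx hy
    change x * e = e * x at hx
    change y * e = e * y at hy
    change (x + y) * e = e * (x + y)
    rw [add_mul, mul_add, hx, hy]
  zero_mem' := by simp
  smul_mem' := by
    intro c x hx
    change x * e = e * x at hx
    change (c • x) * e = e * (c • x)
    rw [smul_mul_assoc, mul_smul_comm, hx]
  lie_mem' := by
    intro x y hx hy
    change x * e = e * x at hx
    change y * e = e * y at hy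
    change (x * y - y * x) * e = e * (x * y - y * x)
    rw [sub_mul, mul_sub, mul_assoc, hy, ← mul_assoc, hx, mul_assoc y, hx, ← mul_assoc y, hy,
      mul_assoc, mul_assoc]

/-- `w 0, …, w (k-1)` are generators of the Jordan blocks of the nilpotent map `e`, the `i`-th
block having dimension `d i + 1`: the vectors `e ^ s (w i)` with `0 ≤ s ≤ d i` form a basis of `V`
and `e ^ (d i + 1) (w i) = 0`. -/
structure IsJordanSystem {K V : Type*} [Field K] [AddCommGroup V] [Module K V]
    (e : Module.End K V) {k : ℕ} (d : Fin k → ℕ) (w : Fin k → V) : Prop where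
  pow_eq_zero : ∀ i, (e ^ (d i + 1)) (w i) = 0
  linearIndependent :
    LinearIndependent K (fun p : (Σ i : Fin k, Fin (d i + 1)) => (e ^ (p.2 : ℕ)) (w p.1))
  span_eq_top :
    Submodule.span K
      (Set.range (fun p : (Σ i : Fin k, Fin (d i + 1)) => (e ^ (p.2 : ℕ)) (w p.1))) = ⊤

namespace IsJordanSystem

variable {K V : Type*} [Field K] [AddCommGroup V] [Module K V]
  {e : Module.End K V} {k : ℕ} {d : Fin k → ℕ} {w : Fin k → V}

/-- The basis `e ^ s (w i)`, `0 ≤ s ≤ d i`, of `V`. -/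
def basis (h : IsJordanSystem e d w) : Module.Basis (Σ i : Fin k, Fin (d i + 1)) K V :=
  Module.Basis.mk h.linearIndependent h.span_eq_top.ge

theorem basis_apply (h : IsJordanSystem e d w) (p : Σ i : Fin k, Fin (d i + 1)) :
    h.basis p = (e ^ (p.2 : ℕ)) (w p.1) := by
  simp [basis]

/-- The coefficient `c_i^{j,s}(φ)`, that is, `φ (w i) = ∑ j s, c_i^{j,s}(φ) • e ^ s (w j)`. -/
def coeff (h : IsJordanSystem e d w) (φ : Module.End K V) (i j : Fin k) (s : Fin (d j + 1)) : K :=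
  h.basis.repr (φ (w i)) ⟨j, s⟩

/-- The covector `α(φ) = ∑ i, a i * c_i^{i, d i}(φ)` on the centraliser of `e`. -/
def covector (h : IsJordanSystem e d w) (a : Fin k → K) : Module.Dual K (glCentralizer e) where
  toFun φ := ∑ i, a i * h.coeff φ i i (Fin.last (d i))
  map_add' := by
    intro φ ψ
    simp [coeff, mul_add, Finset.sum_add_distrib]
  map_smul' := by
    intro c φ
    change ∑ i, a i * h.basis.repr (c • (φ : Module.End K V) (w i)) ⟨i, Fin.last (d i)⟩ =
      c * ∑ i, a i * h.basis.repr ((φ : Module.End K V) (w i)) ⟨i, Fin.last (d i)⟩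
    simp only [map_smul, Finsupp.smul_apply, smul_eq_mul, Finset.mul_sum]
    exact Finset.sum_congr rfl fun i _ => by ring

/-- The space of the `i`-th Jordan block. -/
def block (_h : IsJordanSystem e d w) (i : Fin k) : Submodule K V :=
  Submodule.span K (Set.range fun s : Fin (d i + 1) => (e ^ (s : ℕ)) (w i))

/-- The linear map with `e ^ r (w i) ↦ e ^ (r + s) (w j)` that kills the other Jordan blocks. -/
def xiMap (h : IsJordanSystem e d w) (i j : Fin k) (s : ℕ) : Module.End K V :=
  h.basis.constr K fun p => if p.1 = i then (e ^ ((p.2 : ℕ) + s)) (w j) else 0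

theorem pow_apply_eq_zero (h : IsJordanSystem e d w) {j : Fin k} {m : ℕ} (hm : d j + 1 ≤ m) :
    (e ^ m) (w j) = 0 := by
  obtain ⟨c, rfl⟩ := Nat.exists_eq_add_of_le' hm
  rw [pow_add, Module.End.mul_apply, h.pow_eq_zero, map_zero]

theorem xiMap_pow_apply (h : IsJordanSystem e d w) {i j : Fin k} {s : ℕ} (hs : d j ≤ d i + s)
    (t : Fin k) (r : ℕ) :
    h.xiMap i j s ((e ^ r) (w t)) = if t = i then (e ^ (r + s)) (w j) else 0 := by
  by_cases hr : r < d t + 1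
  · have := h.basis_apply ⟨t, ⟨r, hr⟩⟩
    simp only at this
    rw [← this, xiMap, Module.Basis.constr_basis]
  · rw [h.pow_apply_eq_zero (not_lt.mp hr), map_zero]
    split_ifs with hti
    · subst hti
      rw [h.pow_apply_eq_zero (by omega)]
    · rfl

theorem xiMap_mem (h : IsJordanSystem e d w) {i j : Fin k} {s : ℕ} (hs : d j ≤ d i + s) :
    h.xiMap i j s ∈ glCentralizer e := by
  change h.xiMap i j s * e = e * h.xiMap i j s
  refine h.basis.ext fun p => ?_
  have hp : e ((e ^ (p.2 : ℕ)) (w p.1)) = (e ^ ((p.2 : ℕ) + 1)) (w p.1) := by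
    rw [pow_succ', Module.End.mul_apply]
  rw [h.basis_apply, Module.End.mul_apply, Module.End.mul_apply, hp, h.xiMap_pow_apply hs,
    h.xiMap_pow_apply hs]
  split_ifs
  · rw [← Module.End.mul_apply, ← pow_succ', Nat.add_right_comm]
  · rw [map_zero]

/-- The element `ξ_i^{j,s}` of the centraliser of `e` with `w i ↦ e ^ s (w j)` and `w t ↦ 0` for
`t ≠ i`; it exists as soon as `d j - d i ≤ s`. -/
def xi (h : IsJordanSystem e d w) (i j : Fin k) (s : ℕ) (hs : d j ≤ d i + s) : glCentralizer e :=
  ⟨h.xiMap i j s, h.xiMap_mem hs⟩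

/-- The block-preserving map `ξ_i^{i,s}`. -/
def xiDiag (h : IsJordanSystem e d w) (i : Fin k) (s : Fin (d i + 1)) : glCentralizer e :=
  h.xi i i s (Nat.le_add_right _ _)

theorem xiDiag_apply (h : IsJordanSystem e d w) (i : Fin k) (s : Fin (d i + 1)) (t : Fin k) :
    (h.xiDiag i s : Module.End K V) (w t) = if t = i then (e ^ (s : ℕ)) (w i) else 0 := by
  have := h.xiMap_pow_apply (i := i) (j := i) (s := s) (Nat.le_add_right _ _) t 0
  change h.xiMap i i s (w t) = _
  simpa using this

end IsJordanSystem

end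

/-!
The stabiliser of the covector `α = ∑ aᵢ cᵢ^{i,dᵢ}` is found by pairing with the elements
`ξ_i^{j,s}`. Let `γ m` be the coefficient of `e ^ (d j) (w j)` in `e ^ m (φ (w i))`, for `φ` in the
stabiliser and `i ≠ j`. Then `α ⁅φ, ξ_j^{i,s}⁆ = 0` reads `a j * γ s = a i * γ (d j + s - d i)`
(`IsJordanSystem.covector_lie_xi`). If `d i = d j`, then `γ = 0` because `a i ≠ a j`; otherwise `γ`
is proportional to a proper shift of itself and vanishes far out, so it is zero. Only the scalar of
the larger of two blocks has to be invertible here. Hence `φ` preserves the blocks and is a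
combination of the `ξ_i^{i,s}`, which lie in the stabiliser and are `dim V` in number
(`IsJordanSystem.stabilizer_covector`). Over a field with at least `k` elements the `a i` can be
chosen distinct with a zero at most at a block of minimal size, which bounds the index from above.

For the lower bound, valid for every endomorphism `A` over every field, write a covector on the
centraliser of `A` as `φ ↦ tr (B φ)`. The centraliser of `A + X B` in the matrices over `K[X]` has
rank at least `n = dim V`, because every endomorphism over the field of fractions has a centraliser
of dimension at least `n` (`finrank_le_finrank_glCentralizer`). This lattice is saturated, so the
constant terms of a basis stay linearly independent over `K`, and comparing the coefficients of `1`
and `X` shows that they stabilise the covector (`Matrix.card_le_finrank_of_pencil`,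
`finrank_le_finrank_coadjointStabilizer`).

The rank of `𝔤𝔩(V)` is unchanged by field extension since the structure constants are. Over an
infinite field it is at least `n` by the same bound on centralisers, applied to a regular element,
and at most `n` by looking at a diagonal matrix with distinct entries (`LieAlgebra.rank_end`).
Jordan generators exist by the structure theorem for modules over `K[X]`
(`exists_isJordanSystem`).
-/

/-! ### The stabiliser of the distinguished covector -/

/-- An eventually vanishing sequence that is proportional to a proper shift of itself vanishes. -/
theorem eq_zero_of_eq_mul_shift {K : Type*} [Field K] {γ : ℕ → K} {N δ : ℕ} {c : K}
    (hδ : 0 < δ) (hN : ∀ m, N < m → γ m = 0) (hγ : ∀ m, γ m = c * γ (m + δ)) (m : ℕ) :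
    γ m = 0 := by
  induction hm : N + 1 - m using Nat.strong_induction_on generalizing m with
  | _ n ih =>
    by_cases h : N < m
    · exact hN m h
    · rw [hγ, ih (N + 1 - (m + δ)) (by omega) (m + δ) rfl, mul_zero]

namespace IsJordanSystem

open Module

variable {K V : Type*} [Field K] [AddCommGroup V] [Module K V]
  {e : Module.End K V} {k : ℕ} {d : Fin k → ℕ} {w : Fin k → V}

theorem hom_ext (h : IsJordanSystem e d w) {M : Type*} [AddCommGroup M] [Module K M]
    {f g : V →ₗ[K] M} (hfg : ∀ t r, f ((e ^ r) (w t)) = g ((e ^ r) (w t))) : f = g :=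
  h.basis.ext fun p => by rw [h.basis_apply, hfg]

/-- The coordinate along the last vector `e ^ (d j) (w j)` of the `j`-th block. -/
noncomputable def topCoord (h : IsJordanSystem e d w) (j : Fin k) : V →ₗ[K] K :=
  h.basis.coord ⟨j, Fin.last (d j)⟩

theorem topCoord_pow (h : IsJordanSystem e d w) (j l : Fin k) (m : ℕ) :
    h.topCoord j ((e ^ m) (w l)) = if l = j ∧ m = d j then 1 else 0 := by
  by_cases hm : m < d l + 1
  · have := h.basis_apply ⟨l, ⟨m, hm⟩⟩
    simp only at this
    rw [← this, topCoord, Basis.coord_apply, Basis.repr_self, Finsupp.single_apply]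
    congr 1
    simp only [Sigma.mk.injEq, eq_iff_iff]
    constructor
    · rintro ⟨rfl, h2⟩
      simpa [Fin.ext_iff] using h2
    · rintro ⟨rfl, h2⟩
      simpa [Fin.ext_iff] using h2
  · rw [h.pow_apply_eq_zero (not_lt.mp hm), map_zero, if_neg]
    rintro ⟨rfl, h2⟩
    omega

/-- All coordinates can be read off from the top ones after applying powers of `e`. -/
theorem coord_eq_topCoord_pow (h : IsJordanSystem e d w) (j : Fin k) (s : Fin (d j + 1)) (v : V) :
    h.basis.repr v ⟨j, s⟩ = h.topCoord j ((e ^ (d j - s : ℕ)) v) := by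
  suffices h.basis.coord ⟨j, s⟩ = h.topCoord j ∘ₗ (e ^ (d j - s : ℕ)) from
    LinearMap.congr_fun this v
  refine h.basis.ext fun p => ?_
  rw [LinearMap.comp_apply, h.basis_apply, ← Module.End.mul_apply, ← pow_add, topCoord_pow,
    ← h.basis_apply, Basis.coord_apply, Basis.repr_self, Finsupp.single_apply]
  obtain ⟨l, r⟩ := p
  congr 1
  simp only [Sigma.mk.injEq, eq_iff_iff]
  have := s.is_lt
  constructor
  · rintro ⟨rfl, h2⟩
    rw [heq_eq_eq] at h2
    subst h2
    exact ⟨rfl, by omega⟩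
  · rintro ⟨rfl, h2⟩
    exact ⟨rfl, by rw [heq_eq_eq, Fin.ext_iff]; omega⟩

theorem topCoord_pow_eq_zero (h : IsJordanSystem e d w) {j : Fin k} {m : ℕ} (hm : d j < m)
    (v : V) : h.topCoord j ((e ^ m) v) = 0 := by
  suffices h.topCoord j ∘ₗ (e ^ m) = 0 from LinearMap.congr_fun this v
  refine h.hom_ext fun t r => ?_
  rw [LinearMap.comp_apply, ← Module.End.mul_apply, ← pow_add, topCoord_pow, if_neg (by omega),
    LinearMap.zero_apply]

theorem topCoord_xiMap (h : IsJordanSystem e d w) {i j : Fin k} {s : ℕ} (hs : d j ≤ d i + s)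
    (u : Fin k) (v : V) :
    h.topCoord u (h.xiMap i j s v) =
      if u = j then h.topCoord i ((e ^ (d i + s - d j)) v) else 0 := by
  suffices h.topCoord u ∘ₗ h.xiMap i j s =
      if u = j then h.topCoord i ∘ₗ (e ^ (d i + s - d j)) else 0 by
    have := LinearMap.congr_fun this v
    split_ifs at this ⊢ <;> exact this
  refine h.hom_ext fun t r => ?_
  rw [LinearMap.comp_apply, h.xiMap_pow_apply hs]
  by_cases hu : u = j
  · subst hu
    rw [if_pos rfl, LinearMap.comp_apply, ← Module.End.mul_apply, ← pow_add, topCoord_pow]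
    by_cases ht : t = i
    · rw [if_pos ht, topCoord_pow]
      congr 1
      simp only [ht, true_and, eq_iff_iff]
      omega
    · simp [ht]
  · rw [if_neg hu, LinearMap.zero_apply]
    split_ifs
    · rw [topCoord_pow, if_neg fun h => hu h.1.symm]
    · exact map_zero _

theorem commute_pow_apply {φ : Module.End K V} (hφ : φ ∈ glCentralizer e) (r : ℕ) (v : V) :
    φ ((e ^ r) v) = (e ^ r) (φ v) :=
  LinearMap.congr_fun (Commute.pow_right (show Commute φ e from hφ) r) v

theorem covector_apply (h : IsJordanSystem e d w) (a : Fin k → K) (φ : glCentralizer e) :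
    h.covector a φ = ∑ i, a i * h.topCoord i ((φ : Module.End K V) (w i)) := rfl

/-- Pairing `φ` with `ξ_i^{j,s}` only sees the component of `φ` from the `j`-th block to the
`i`-th one. -/
theorem covector_lie_xi (h : IsJordanSystem e d w) (a : Fin k → K) (φ : glCentralizer e)
    {i j : Fin k} {s : ℕ} (hs : d j ≤ d i + s) :
    h.covector a ⁅φ, h.xi i j s hs⁆ =
      a i * h.topCoord i ((e ^ s) ((φ : Module.End K V) (w j))) -
      a j * h.topCoord i ((e ^ (d i + s - d j)) ((φ : Module.End K V) (w j))) := by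
  have hw (t : Fin k) : h.xiMap i j s (w t) = if t = i then (e ^ s) (w j) else 0 := by
    simpa using h.xiMap_pow_apply hs t 0
  have hlie (u : Fin k) : ((⁅φ, h.xi i j s hs⁆ : glCentralizer e) : Module.End K V) (w u) =
      (φ : Module.End K V) (h.xiMap i j s (w u)) -
      h.xiMap i j s ((φ : Module.End K V) (w u)) := rfl
  simp only [covector_apply, hlie, map_sub, mul_sub, Finset.sum_sub_distrib,
    h.topCoord_xiMap hs, hw]
  congr 1
  · rw [Finset.sum_eq_single i]
    · rw [if_pos rfl, commute_pow_apply φ.2]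
    · intro b _ hb
      simp [hb]
    · simp
  · simp

/-- The off-diagonal components of an element of the stabiliser vanish. The coefficients of the
component from block `i` to block `j` satisfy a recursion that relates each of them to the one
shifted by `d j - d i`. -/
theorem topCoord_eq_zero_of_mem_stabilizer (h : IsJordanSystem e d w) {a : Fin k → K}
    (ha : Function.Injective a) (ha0 : ∀ i j, d i < d j → a j ≠ 0) {φ : glCentralizer e}
    (hφ : φ ∈ coadjointStabilizer (h.covector a)) {i j : Fin k} (hij : i ≠ j) (m : ℕ) :
    h.topCoord j ((e ^ m) ((φ : Module.End K V) (w i))) = 0 := by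
  set γ : ℕ → K := fun m => h.topCoord j ((e ^ m) ((φ : Module.End K V) (w i)))
  have hN (m : ℕ) (hm : d j < m) : γ m = 0 := h.topCoord_pow_eq_zero hm _
  -- The sequence `γ` is the coefficients of the component, in decreasing order of powers of `e`.
  have key (s : ℕ) (hs : d i ≤ d j + s) : a j * γ s = a i * γ (d j + s - d i) := by
    have := hφ (h.xi j i s hs)
    rwa [h.covector_lie_xi, sub_eq_zero] at this
  change γ m = 0
  rcases lt_trichotomy (d i) (d j) with hd | hd | hd
  · refine eq_zero_of_eq_mul_shift (δ := d j - d i) (c := (a j)⁻¹ * a i) (by omega) hN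
      (fun m => ?_) m
    rw [mul_assoc, eq_inv_mul_iff_mul_eq₀ (ha0 i j hd), key m (by omega)]
    congr 2
    omega
  · have := key m (by omega)
    rw [hd, Nat.add_sub_cancel_left, ← sub_eq_zero, ← sub_mul, mul_eq_zero, sub_eq_zero] at this
    exact this.resolve_left fun h' => hij (ha h').symm
  · refine eq_zero_of_eq_mul_shift (δ := d i - d j) (c := (a i)⁻¹ * a j) (by omega) hN
      (fun m => ?_) m
    rw [mul_assoc, eq_inv_mul_iff_mul_eq₀ (ha0 j i hd), key (m + (d i - d j)) (by omega)]
    congr 2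
    omega

theorem pow_mem_block (h : IsJordanSystem e d w) (i : Fin k) (r : ℕ) :
    (e ^ r) (w i) ∈ h.block i := by
  by_cases hr : r < d i + 1
  · exact Submodule.subset_span ⟨⟨r, hr⟩, rfl⟩
  · rw [h.pow_apply_eq_zero (not_lt.mp hr)]
    exact zero_mem _

theorem block_le_comap_pow (h : IsJordanSystem e d w) (i : Fin k) (r : ℕ) :
    h.block i ≤ (h.block i).comap (e ^ r) := by
  refine Submodule.span_le.mpr ?_
  rintro _ ⟨s, rfl⟩
  simp only [SetLike.mem_coe, Submodule.mem_comap]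
  rw [← Module.End.mul_apply, ← pow_add]
  exact h.pow_mem_block i _

/-- Since the off-diagonal components of an element of the stabiliser vanish, it sends each
generator, hence each block, into the block. -/
theorem map_block_le (h : IsJordanSystem e d w) {a : Fin k → K}
    (ha : Function.Injective a) (ha0 : ∀ i j, d i < d j → a j ≠ 0) {φ : glCentralizer e}
    (hφ : φ ∈ coadjointStabilizer (h.covector a)) (i : Fin k) :
    (h.block i).map (φ : Module.End K V) ≤ h.block i := by
  have hwi : (φ : Module.End K V) (w i) ∈ h.block i := by
    rw [← h.basis.sum_repr ((φ : Module.End K V) (w i))]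
    refine Submodule.sum_mem _ ?_
    rintro ⟨j, s⟩ -
    by_cases hij : i = j
    · subst hij
      rw [h.basis_apply]
      exact Submodule.smul_mem _ _ (h.pow_mem_block _ _)
    · rw [coord_eq_topCoord_pow, h.topCoord_eq_zero_of_mem_stabilizer ha ha0 hφ hij, zero_smul]
      exact zero_mem _
  rw [Submodule.map_le_iff_le_comap]
  refine Submodule.span_le.mpr ?_
  rintro _ ⟨s, rfl⟩
  simp only [SetLike.mem_coe, Submodule.mem_comap]
  rw [commute_pow_apply φ.2]
  exact h.block_le_comap_pow i s hwi

/-- A block-preserving element of the centraliser is determined by the images of the generators,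
and these are matched by a combination of the `ξ_i^{i,s}`. -/
theorem mem_span_xiDiag (h : IsJordanSystem e d w) {φ : glCentralizer e}
    (hφ : ∀ i, (h.block i).map (φ : Module.End K V) ≤ h.block i) :
    φ ∈ Submodule.span K
      (Set.range fun p : (Σ i : Fin k, Fin (d i + 1)) => h.xiDiag p.1 p.2) := by
  have hwi (i : Fin k) : (φ : Module.End K V) (w i) ∈ h.block i :=
    hφ i ⟨w i, by simpa using h.pow_mem_block i 0, rfl⟩
  simp only [block, Submodule.mem_span_range_iff_exists_fun] at hwi
  choose c hc using hwi
  have : φ = ∑ i, ∑ s, c i s • h.xiDiag i s := by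
    refine Subtype.ext (h.hom_ext fun t r => ?_)
    rw [commute_pow_apply φ.2, commute_pow_apply (Subtype.prop _)]
    congr 1
    have hsum : ((∑ i, ∑ s, c i s • h.xiDiag i s : glCentralizer e) : Module.End K V) =
        ∑ i, ∑ s, c i s • (h.xiDiag i s : Module.End K V) := by
      change (glCentralizer e).toSubmodule.subtype _ = _
      simp only [map_sum, map_smul]
      rfl
    rw [hsum, ← hc t]
    simp [LinearMap.sum_apply, xiDiag_apply, Finset.sum_ite_eq]
  rw [this]
  exact Submodule.sum_mem _ fun i _ => Submodule.sum_mem _ fun s _ =>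
    Submodule.smul_mem _ _ (Submodule.subset_span ⟨⟨i, s⟩, rfl⟩)

/-- For `i = j` the two terms in `covector_lie_xi` cancel. -/
theorem xiDiag_mem_stabilizer (h : IsJordanSystem e d w) (a : Fin k → K) (i : Fin k)
    (s : Fin (d i + 1)) : h.xiDiag i s ∈ coadjointStabilizer (h.covector a) := by
  intro η
  rw [← lie_skew, map_neg, xiDiag, h.covector_lie_xi, Nat.add_sub_cancel_left, sub_self, neg_zero]

theorem linearIndependent_xiDiag (h : IsJordanSystem e d w) :
    LinearIndependent K fun p : (Σ i : Fin k, Fin (d i + 1)) => h.xiDiag p.1 p.2 := by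
  -- Evaluation at the sum of all generators maps the family to the Jordan basis.
  let ev : glCentralizer e →ₗ[K] V :=
    LinearMap.applyₗ (∑ t, w t) ∘ₗ (glCentralizer e).toSubmodule.subtype
  refine LinearIndependent.of_comp ev ?_
  convert! h.linearIndependent with p
  change (h.xiDiag p.1 p.2 : Module.End K V) (∑ t, w t) = _
  simp [map_sum, xiDiag_apply]

/-- The description of the stabiliser, for scalars that may vanish on blocks of minimal size.
Allowing this is what makes `k` elements of the field, rather than `k + 1`, enough for computing
the index. -/
theorem stabilizer_covector (h : IsJordanSystem e d w) {a : Fin k → K}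
    (ha : Function.Injective a) (ha0 : ∀ i j, d i < d j → a j ≠ 0) :
    (∀ φ : glCentralizer e, φ ∈ coadjointStabilizer (h.covector a) ↔
      ∀ i, (h.block i).map (φ : Module.End K V) ≤ h.block i) ∧
    (coadjointStabilizer (h.covector a)).toSubmodule =
      Submodule.span K (Set.range fun p : (Σ i : Fin k, Fin (d i + 1)) => h.xiDiag p.1 p.2) ∧
    finrank K (coadjointStabilizer (h.covector a)) = finrank K V := by
  have hle : Submodule.span K
      (Set.range fun p : (Σ i : Fin k, Fin (d i + 1)) => h.xiDiag p.1 p.2) ≤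
      (coadjointStabilizer (h.covector a)).toSubmodule := by
    refine Submodule.span_le.mpr ?_
    rintro _ ⟨p, rfl⟩
    exact h.xiDiag_mem_stabilizer a _ _
  have heq : (coadjointStabilizer (h.covector a)).toSubmodule =
      Submodule.span K (Set.range fun p : (Σ i : Fin k, Fin (d i + 1)) => h.xiDiag p.1 p.2) :=
    le_antisymm (fun φ hφ => h.mem_span_xiDiag (h.map_block_le ha ha0 hφ)) hle
  refine ⟨fun φ => ⟨fun hφ => h.map_block_le ha ha0 hφ, fun hφ => hle (h.mem_span_xiDiag hφ)⟩,
    heq, ?_⟩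
  change finrank K (coadjointStabilizer (h.covector a)).toSubmodule = _
  rw [heq, finrank_span_eq_card h.linearIndependent_xiDiag, finrank_eq_card_basis h.basis]

end IsJordanSystem

/-! ### Dimension of centralisers -/

section Commutant

open Module Polynomial

/-- The centraliser of an endomorphism `f` of `W` has dimension at least `dim W`. As an
`F[X]`-module, `W` is isomorphic to a commutative `F[X]`-algebra, namely a product of cyclic
modules, and multiplication embeds this algebra into the centraliser. -/
theorem finrank_le_finrank_glCentralizer {F W : Type*} [Field F] [AddCommGroup W] [Module F W]
    [FiniteDimensional F W] (f : Module.End F W) : finrank F W ≤ finrank F (glCentralizer f) := by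
  classical
  obtain ⟨ι, _, p, -, n, ⟨g₀⟩⟩ := Module.equiv_directSum_of_isTorsion
    (Module.AEval.isTorsion_of_finiteDimensional F W f)
  let g : AEval' f ≃ₗ[F[X]] (Π i, F[X] ⧸ Submodule.span F[X] {p i ^ n i}) :=
    g₀.trans (DirectSum.linearEquivFunOnFintype F[X] ι _)
  let G : W ≃ₗ[F] (Π i, F[X] ⧸ Ideal.span {p i ^ n i}) :=
    (AEval'.of f).trans (g.restrictScalars F)
  have hG (x : W) : G (f x) = (X : F[X]) • G x := by
    change g (AEval'.of f (f x)) = (X : F[X]) • g (AEval'.of f x)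
    rw [← AEval'.X_smul_of, map_smul]
  have hsmul (c : F) (y : Π i, F[X] ⧸ Ideal.span {p i ^ n i}) : c • y = (C c : F[X]) • y :=
    (algebraMap_smul F[X] c y).symm
  let Φ : W →ₗ[F] Module.End F W :=
    LinearMap.mk₂ F (fun v x => G.symm (G v * G x))
      (fun _ _ _ => by simp [add_mul])
      (fun c v x => by rw [map_smul, hsmul, smul_mul_assoc, ← hsmul, map_smul])
      (fun _ _ _ => by simp [mul_add])
      (fun c v x => by rw [map_smul, hsmul, mul_smul_comm, ← hsmul, map_smul])
  have hΦ (v : W) : Φ v ∈ (glCentralizer f).toSubmodule := by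
    refine LinearMap.ext fun x => G.injective ?_
    change G (G.symm (G v * G (f x))) = G (f (G.symm (G v * G x)))
    rw [hG, hG, G.apply_symm_apply, G.apply_symm_apply, mul_smul_comm]
  refine LinearMap.finrank_le_finrank_of_injective (f := Φ.codRestrict _ hΦ) fun v v' hv => ?_
  have : G.symm (G v * G (G.symm 1)) = G.symm (G v' * G (G.symm 1)) :=
    LinearMap.congr_fun (congrArg Subtype.val hv) (G.symm 1)
  simpa using this

end Commutant

/-! ### Degeneration of centralisers over a polynomial ring -/

section Pencil

open Module Polynomial

variable {K : Type*} [Field K] {n : Type*} [Fintype n]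

theorem Matrix.map_coeff_mul_map_C (x : Matrix n n K[X]) (A : Matrix n n K) (m : ℕ) :
    (x * A.map C).map (coeff · m) = x.map (coeff · m) * A := by
  ext i j
  simp [Matrix.mul_apply]

theorem Matrix.map_coeff_map_C_mul (x : Matrix n n K[X]) (A : Matrix n n K) (m : ℕ) :
    (A.map C * x).map (coeff · m) = A * x.map (coeff · m) := by
  ext i j
  simp [Matrix.mul_apply]

/-- The centraliser of a square matrix over a polynomial ring, as a module over that ring. -/
def Matrix.polyCentralizer (P : Matrix n n K[X]) : Submodule K[X] (Matrix n n K[X]) where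
  carrier := {x | x * P = P * x}
  add_mem' hx hy := by
    simp only [Set.mem_ofPred_eq] at *
    rw [add_mul, mul_add, hx, hy]
  zero_mem' := by simp
  smul_mem' c x hx := by
    simp only [Set.mem_ofPred_eq] at *
    rw [smul_mul_assoc, mul_smul_comm, hx]

variable [DecidableEq n]

/-- Clearing denominators in a basis of the centraliser over the field of fractions. -/
theorem Matrix.card_le_finrank_polyCentralizer (P : Matrix n n K[X]) :
    Fintype.card n ≤ finrank K[X] P.polyCentralizer := by
  let L := FractionRing K[X]
  let Q : Matrix n n L := P.map (algebraMap K[X] L)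
  have hdim : Fintype.card n ≤ finrank L (glCentralizer (Matrix.toLin' Q)) := by
    simpa using finrank_le_finrank_glCentralizer (Matrix.toLin' Q)
  obtain ⟨v, hv⟩ := exists_linearIndependent_of_le_finrank hdim
  let u : Fin (Fintype.card n) → Matrix n n L := fun i => LinearMap.toMatrix' (v i : Module.End L _)
  have hu : LinearIndependent L u :=
    (hv.map' (glCentralizer (Matrix.toLin' Q)).toSubmodule.subtype
      (Submodule.ker_subtype _)).map' _ (LinearMap.toMatrix' (R := L) (m := n) (n := n)).ker
  have huQ (i) : u i * Q = Q * u i := by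
    have : (v i : Module.End L (n → L)) * Matrix.toLin' Q =
        Matrix.toLin' Q * (v i : Module.End L (n → L)) := (v i).2
    have := congrArg LinearMap.toMatrix' this
    simpa [LinearMap.toMatrix'_mul, u] using this
  obtain ⟨c, hc⟩ := IsLocalization.exist_integer_multiples_of_finite (nonZeroDivisors K[X])
    (fun q : Fin (Fintype.card n) × n × n => u q.1 q.2.1 q.2.2)
  choose y hy using hc
  let z : Fin (Fintype.card n) → Matrix n n K[X] := fun i => Matrix.of fun a b => y (i, a, b)
  have hc0 : algebraMap K[X] L c ≠ 0 := IsFractionRing.to_map_ne_zero_of_mem_nonZeroDivisors c.2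
  have hz (i) : (z i).map (algebraMap K[X] L) = algebraMap K[X] L c • u i := by
    ext a b
    change algebraMap K[X] L (y (i, a, b)) = _
    rw [hy, Algebra.smul_def]
    rfl
  have hzmem (i) : z i ∈ P.polyCentralizer := by
    refine Matrix.map_injective (IsFractionRing.injective K[X] L) ?_
    change (z i * P).map (algebraMap K[X] L) = (P * z i).map (algebraMap K[X] L)
    rw [Matrix.map_mul, Matrix.map_mul, hz]
    change _ • u i * Q = Q * _ • u i
    rw [smul_mul_assoc, mul_smul_comm, huQ]
  have hzli : LinearIndependent K[X] z := by
    refine LinearIndependent.of_comp (Algebra.linearMap K[X] L).mapMatrix ?_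
    have : (Algebra.linearMap K[X] L).mapMatrix ∘ z = fun i => algebraMap K[X] L c • u i :=
      funext hz
    rw [this]
    exact (hu.units_smul fun _ => Units.mk0 _ hc0).restrict_scalars' K[X]
  have : LinearIndependent K[X] fun i => (⟨z i, hzmem i⟩ : P.polyCentralizer) :=
    LinearIndependent.of_comp P.polyCentralizer.subtype hzli
  simpa using this.fintype_card_le_finrank

/-- The degeneration argument: reducing a basis of the centraliser of `A + X • B` over `K[X]`
modulo `X` gives at least `n` linearly independent matrices `x` that commute with `A` and for
which `x * B - B * x` is a commutator with `A`. -/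
theorem Matrix.card_le_finrank_of_pencil (A B : Matrix n n K) (S : Submodule K (Matrix n n K))
    (hS : ∀ x y, x * A = A * x → x * B - B * x = A * y - y * A → x ∈ S) :
    Fintype.card n ≤ finrank K S := by
  let P : Matrix n n K[X] := A.map C + (X : K[X]) • B.map C
  have hX0 (y : Matrix n n K[X]) : ((X : K[X]) • y).map (coeff · 0) = 0 := by
    ext; simp
  have hX1 (y : Matrix n n K[X]) : ((X : K[X]) • y).map (coeff · 1) = y.map (coeff · 0) := by
    ext; simp
  have hadd (y y' : Matrix n n K[X]) (m : ℕ) :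
      (y + y').map (coeff · m) = y.map (coeff · m) + y'.map (coeff · m) := by
    ext; simp
  have hmem (x : P.polyCentralizer) : (x : Matrix n n K[X]).map (coeff · 0) ∈ S := by
    have hx : (x : Matrix n n K[X]) * P = P * x := x.2
    have h0 := congrArg (Matrix.map · (coeff · 0)) hx
    have h1 := congrArg (Matrix.map · (coeff · 1)) hx
    simp only [P, mul_add, add_mul, smul_mul_assoc, mul_smul_comm, hadd, hX0, hX1, add_zero,
      Matrix.map_coeff_map_C_mul, Matrix.map_coeff_mul_map_C] at h0 h1
    refine hS _ ((x : Matrix n n K[X]).map (coeff · 1)) h0 ?_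
    rw [sub_eq_sub_iff_add_eq_add, add_comm, h1]
  let b := Module.finBasis K[X] P.polyCentralizer
  have hli : LinearIndependent K
      fun i => (⟨(b i : Matrix n n K[X]).map (coeff · 0), hmem (b i)⟩ : S) := by
    refine LinearIndependent.of_comp S.subtype ?_
    rw [Fintype.linearIndependent_iff]
    intro c hc
    let y : P.polyCentralizer := ∑ i, C (c i) • b i
    have hy : (y : Matrix n n K[X]).map (coeff · 0) = 0 := by
      rw [← hc]
      ext i j
      simp [y, Matrix.sum_apply]
    let z : Matrix n n K[X] := (y : Matrix n n K[X]).map divX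
    have hyz : (y : Matrix n n K[X]) = (X : K[X]) • z := by
      ext1 i j
      have h0 : ((y : Matrix n n K[X]) i j).coeff 0 = 0 := congrFun (congrFun hy i) j
      have := X_mul_divX_add ((y : Matrix n n K[X]) i j)
      rw [h0, C_0, add_zero] at this
      exact this.symm
    -- The centraliser is saturated: if it contains `X • z` then it contains `z`.
    have hz : z ∈ P.polyCentralizer := by
      have hyP : (y : Matrix n n K[X]) * P = P * y := y.2
      rw [hyz, smul_mul_assoc, mul_smul_comm] at hyP
      exact smul_right_injective _ X_ne_zero hyP
    have hyz' : y = (X : K[X]) • (⟨z, hz⟩ : P.polyCentralizer) := Subtype.ext hyz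
    intro i
    have hi : b.repr y i = C (c i) := by
      simp only [y]
      rw [Basis.repr_sum_self]
    rw [hyz', map_smul, Finsupp.smul_apply, smul_eq_mul] at hi
    simpa using (congrArg (coeff · 0) hi).symm
  have := hli.fintype_card_le_finrank
  rw [Fintype.card_fin] at this
  exact P.card_le_finrank_polyCentralizer.trans this

end Pencil

/-! ### Lower bound for the index -/

section Index

open Module

variable {K V : Type*} [Field K] [AddCommGroup V] [Module K V] [FiniteDimensional K V]

/-- Write the covector as a trace pairing with some `B`. If `x` commutes with `e` and `x B - B x` is
a commutator with `e`, then `x` stabilises the covector, because commutators with `e` are trace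
orthogonal to the centraliser of `e`. -/
theorem finrank_le_finrank_coadjointStabilizer (e : Module.End K V)
    (α : Module.Dual K (glCentralizer e)) :
    finrank K V ≤ finrank K (coadjointStabilizer α) := by
  obtain ⟨α', hα'⟩ := LinearMap.exists_extend (p := (glCentralizer e).toSubmodule) α
  let b := Module.finBasis K V
  let T := LinearMap.toMatrixAlgEquiv b
  -- The covector is the trace pairing with the matrix `B`.
  let B : Matrix (Fin (finrank K V)) (Fin (finrank K V)) K :=
    Matrix.of fun i j => α' (T.symm (Matrix.single j i 1))
  have hB (M : Matrix _ _ K) : α' (T.symm M) = (B * M).trace := by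
    suffices α' ∘ₗ T.symm.toLinearMap = Matrix.traceLinearMap _ K K ∘ₗ LinearMap.mulLeft K B from
      LinearMap.congr_fun this M
    refine (Matrix.stdBasis K _ _).ext fun p => ?_
    rw [Matrix.stdBasis_eq_single]
    simp [B, Matrix.trace_mul_single]
  let S := (coadjointStabilizer α).toSubmodule.map
    (T.toLinearMap ∘ₗ (glCentralizer e).toSubmodule.subtype)
  refine le_trans ?_ (Submodule.finrank_map_le
    (T.toLinearMap ∘ₗ (glCentralizer e).toSubmodule.subtype) (coadjointStabilizer α).toSubmodule)
  have := Matrix.card_le_finrank_of_pencil (T e) B S fun x y hx hxy => ?_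
  · simpa using this
  · have hxe : T.symm x ∈ glCentralizer e := by
      change T.symm x * e = e * T.symm x
      apply T.injective
      rw [map_mul, map_mul, T.apply_symm_apply, hx]
    refine ⟨⟨T.symm x, hxe⟩, fun η => ?_, T.apply_symm_apply x⟩
    have hη : T η * T e = T e * T η := by
      rw [← map_mul, ← map_mul]
      exact congrArg T η.2
    have h1 : α ⁅(⟨T.symm x, hxe⟩ : glCentralizer e), η⁆ =
        α' (T.symm (x * T η - T η * x)) := by
      rw [← hα', map_sub, map_mul, map_mul, T.symm_apply_apply]
      rfl
    have h2 : (B * (x * T η - T η * x)).trace = -((x * B - B * x) * T η).trace := by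
      rw [mul_sub, sub_mul, Matrix.trace_sub, Matrix.trace_sub, ← mul_assoc, ← mul_assoc,
        Matrix.trace_mul_comm (B * T η) x, ← mul_assoc, neg_sub]
    rw [h1, hB, h2, hxy, sub_mul, Matrix.trace_sub, mul_assoc, Matrix.trace_mul_comm, mul_assoc,
      mul_assoc, hη, sub_self, neg_zero]

theorem finrank_le_lieIndex_glCentralizer (e : Module.End K V) :
    finrank K V ≤ lieIndex K (glCentralizer e) :=
  le_ciInf fun α => finrank_le_finrank_coadjointStabilizer e α

end Index

/-! ### The rank of the general linear Lie algebra -/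

section BasisEnd

open Module

variable {R M ι : Type*} [CommSemiring R] [AddCommMonoid M] [Module R M] [Fintype ι]
  [DecidableEq ι]

theorem Module.Basis.end_repr_eq (b : Basis ι R M) (f : Module.End R M) (p : ι × ι) :
    b.end.repr f p = b.repr (f (b p.2)) p.1 := by
  rw [Basis.linearMap_repr_apply]
  exact LinearMap.toMatrix_apply b b f _ _

theorem Module.Basis.end_mul_end (b : Basis ι R M) (i j : ι × ι) :
    b.end i * b.end j = if i.2 = j.1 then b.end (i.1, j.2) else 0 := by
  refine b.ext fun k => ?_
  rw [Module.End.mul_apply, b.end_apply_apply]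
  split_ifs <;> simp_all [b.end_apply_apply]

end BasisEnd

section BaseChange

open Module

variable {R L M F L' M' ι ιM : Type*} [CommRing R] [AddCommGroup L] [Module R L]
  [AddCommGroup M] [Module R M] [CommRing F] [Algebra R F] [AddCommGroup L'] [Module F L']
  [AddCommGroup M'] [Module F M'] [Fintype ι] [Fintype ιM] [DecidableEq ι] [DecidableEq ιM]
  [Module.Finite R M] [Module.Free R M] [Module.Finite F M'] [Module.Free F M']

/-- If two linear families of endomorphisms, over `R` and over an `R`-algebra `F`, have the same
structure constants, then their generic characteristic polynomials agree. -/
theorem LinearMap.polyCharpoly_eq_map_of_structureConstants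
    (φ : L →ₗ[R] Module.End R M) (φ' : L' →ₗ[F] Module.End F M')
    (b : Basis ι R L) (b' : Basis ι F L') (c : Basis ιM R M) (c' : Basis ιM F M')
    (h : ∀ i p q, c'.repr (φ' (b' i) (c' q)) p = algebraMap R F (c.repr (φ (b i) (c q)) p)) :
    φ'.polyCharpoly b' = (φ.polyCharpoly b).map (MvPolynomial.map (algebraMap R F)) := by
  rw [polyCharpoly_eq_of_basis φ b c, polyCharpoly_eq_of_basis φ' b' c',
    ← Matrix.charpoly.univ_map_map _ (algebraMap R F)]
  simp only [Polynomial.map_map]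
  congr 1
  apply MvPolynomial.ringHom_ext
  · intro r
    simp
  · intro ij
    simp only [RingHom.coe_comp, RingHom.coe_coe, Function.comp_apply, MvPolynomial.map_X,
      MvPolynomial.bind₁_X_right]
    rw [LinearMap.toMvPolynomial, LinearMap.toMvPolynomial, ← Matrix.toMvPolynomial_map]
    congr 1
    ext pq i
    rw [Matrix.map_apply, LinearMap.toMatrix_apply, LinearMap.toMatrix_apply]
    rw [Basis.end_repr_eq, Basis.end_repr_eq, h]

end BaseChange

section Rank

open Module Polynomial

/-- The rank of `𝔤𝔩` does not change under a field extension. -/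
theorem LieAlgebra.rank_end_eq_of_algebra {K V F W ι : Type*} [Field K] [AddCommGroup V]
    [Module K V] [FiniteDimensional K V] [Field F] [Algebra K F] [AddCommGroup W] [Module F W]
    [FiniteDimensional F W] [Fintype ι] [DecidableEq ι] (b : Module.Basis ι K V)
    (b' : Module.Basis ι F W) :
    LieAlgebra.rank K (Module.End K V) = LieAlgebra.rank F (Module.End F W) := by
  have hmap := LinearMap.polyCharpoly_eq_map_of_structureConstants
    (LieAlgebra.ad K (Module.End K V)).toLinearMap (LieAlgebra.ad F (Module.End F W)).toLinearMap
    b.end b'.end b.end b'.end fun i p q => by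
      simp only [LieHom.coe_toLinearMap, LieAlgebra.ad_apply, Ring.lie_def, Basis.end_mul_end,
        map_sub, Finsupp.sub_apply]
      congr 1 <;> split_ifs <;> simp only [map_zero, Finsupp.zero_apply, Basis.repr_self,
        Finsupp.single_apply] <;> split_ifs <;> simp
  rw [LieAlgebra.rank_eq_natTrailingDegree K _ b.end,
    LieAlgebra.rank_eq_natTrailingDegree F _ b'.end, hmap, natTrailingDegree, natTrailingDegree,
    trailingDegree, trailingDegree, support_map_of_injective _
      (MvPolynomial.map_injective _ (algebraMap K F).injective)]

/-- For a regular `x` the rank is the dimension of the generalised kernel of `ad x`, which contains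
the centraliser of `x`. -/
theorem LieAlgebra.finrank_le_rank_end {F W : Type*} [Field F] [Infinite F] [AddCommGroup W]
    [Module F W] [FiniteDimensional F W] :
    finrank F W ≤ LieAlgebra.rank F (Module.End F W) := by
  obtain ⟨x, hx⟩ := LieAlgebra.exists_isRegular F (Module.End F W)
  rw [LieAlgebra.isRegular_iff_finrank_engel_eq_rank] at hx
  rw [← hx]
  refine (finrank_le_finrank_glCentralizer x).trans
    (Submodule.finrank_mono (s := (glCentralizer x).toSubmodule) fun φ hφ => ?_)
  change φ ∈ LieSubalgebra.engel F x
  rw [LieSubalgebra.mem_engel_iff]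
  refine ⟨1, ?_⟩
  rw [pow_one, LieAlgebra.ad_apply]
  exact sub_eq_zero.mpr (show φ * x = x * φ from hφ).symm

/-- For a diagonal `x` with distinct eigenvalues, the factor `X` occurs exactly `dim W` times in the
characteristic polynomial of `ad x`. -/
theorem LieAlgebra.rank_end_le_finrank {F W : Type*} [Field F] [Infinite F] [AddCommGroup W]
    [Module F W] [FiniteDimensional F W] :
    LieAlgebra.rank F (Module.End F W) ≤ finrank F W := by
  let b := Module.finBasis F W
  let a : Fin (finrank F W) ↪ F := Fin.valEmbedding.trans (Infinite.natEmbedding F)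
  let x : Module.End F W := b.constr F fun i => a i • b i
  have hx (i) : x (b i) = a i • b i := b.constr_basis _ _ _
  refine (LieAlgebra.rank_le_natTrailingDegree_charpoly_ad F x).trans ?_
  apply Polynomial.natTrailingDegree_le_of_ne_zero
  have hmat : LinearMap.toMatrix b.end b.end (LieAlgebra.ad F _ x) =
      Matrix.diagonal fun p => a p.1 - a p.2 := by
    ext p q
    rw [LinearMap.toMatrix_apply, LieAlgebra.ad_apply, b.lie_end_of_apply_eq_smul a x hx,
      map_smul, Basis.repr_self, Matrix.diagonal_apply, Finsupp.smul_apply, Finsupp.single_apply]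
    split_ifs <;> simp_all
  rw [← LinearMap.charpoly_toMatrix _ b.end, hmat, Matrix.charpoly_diagonal]
  have hprod : ∏ p : Fin (finrank F W) × Fin (finrank F W), (X - C (a p.1 - a p.2)) =
      X ^ finrank F W * ∏ i, ∏ j ∈ Finset.univ.erase i, (X - C (a i - a j)) := by
    rw [Fintype.prod_prod_type]
    rw [Finset.prod_congr rfl fun i _ => (Finset.mul_prod_erase Finset.univ
      (fun j => (X : F[X]) - C (a i - a j)) (Finset.mem_univ i)).symm]
    simp [Finset.prod_mul_distrib]
  rw [hprod, coeff_X_pow_mul', if_pos le_rfl, Nat.sub_self, coeff_zero_eq_eval_zero]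
  simp only [eval_prod, eval_sub, eval_X, eval_C, zero_sub]
  refine Finset.prod_ne_zero_iff.mpr fun i _ => Finset.prod_ne_zero_iff.mpr fun j hj => ?_
  exact neg_ne_zero.mpr (sub_ne_zero.mpr fun h => Finset.ne_of_mem_erase hj (a.injective h).symm)

/-- The rank of `𝔤𝔩(V)` is `dim V`, over any field. Regular elements and diagonal matrices with
distinct entries need an infinite field, so the rank is computed over an algebraic closure. -/
theorem LieAlgebra.rank_end (K V : Type*) [Field K] [AddCommGroup V] [Module K V]
    [FiniteDimensional K V] : LieAlgebra.rank K (Module.End K V) = finrank K V := by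
  let F := AlgebraicClosure K
  rw [LieAlgebra.rank_end_eq_of_algebra (Module.finBasis K V)
    (Pi.basisFun F (Fin (finrank K V)))]
  refine (le_antisymm LieAlgebra.rank_end_le_finrank LieAlgebra.finrank_le_rank_end).trans ?_
  simp

end Rank

/-! ### Existence of Jordan generators -/

section JordanExistence

open Module Polynomial DirectSum

/-- Existence of Jordan generators: apply the structure theorem to `V` as a `K[X]`-module on which
`X` acts as `e`, and discard the trivial summands. -/
theorem exists_isJordanSystem {K V : Type*} [Field K] [AddCommGroup V] [Module K V]
    [FiniteDimensional K V] {e : Module.End K V} (he : IsNilpotent e) :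
    ∃ (k : ℕ) (d : Fin k → ℕ) (w : Fin k → V), IsJordanSystem e d w := by
  classical
  obtain ⟨N, hN⟩ := he
  have htors : Module.IsTorsion' (AEval' e) (Submonoid.powers (X : K[X])) := fun x => by
    refine ⟨⟨X ^ N, N, rfl⟩, (AEval'.of e).symm.injective ?_⟩
    change (aeval e (X ^ N : K[X])) • ((AEval'.of e).symm x) = 0
    rw [aeval_X_pow, hN, zero_smul]
  obtain ⟨m, n, ⟨g⟩⟩ := Module.torsion_by_prime_power_decomposition (M := AEval' e)
    (p := (X : K[X])) irreducible_X htors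
  let Q (i : Fin m) := K[X] ⧸ Submodule.span K[X] {(X : K[X]) ^ n i}
  let one (i : Fin m) : Q i := Submodule.Quotient.mk 1
  let v (i : Fin m) : V := (AEval'.of e).symm (g.symm (DirectSum.lof K[X] (Fin m) Q i (one i)))
  have hgv (i : Fin m) (s : ℕ) : g (AEval'.of e ((e ^ s) (v i))) =
      DirectSum.lof K[X] (Fin m) Q i ((X : K[X]) ^ s • one i) := by
    have : AEval'.of e ((e ^ s) (v i)) = (X : K[X]) ^ s • AEval'.of e (v i) :=
      (AEval'.X_pow_smul_of e (v i) s).symm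
    rw [this, map_smul, map_smul, LinearEquiv.apply_symm_apply, LinearEquiv.apply_symm_apply]
  have hinj {x y : V} (hxy : g (AEval'.of e x) = g (AEval'.of e y)) : x = y :=
    (AEval'.of e).injective (g.injective hxy)
  have hone (i : Fin m) (p : K[X]) : p • one i = 0 ↔ X ^ n i ∣ p := by
    rw [← Submodule.Quotient.mk_smul, Submodule.Quotient.mk_eq_zero, smul_eq_mul, mul_one,
      ← Ideal.mem_span_singleton]
  have hv0 (i : Fin m) {s : ℕ} (hs : n i ≤ s) : (e ^ s) (v i) = 0 := by
    refine hinj ?_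
    rw [hgv, (hone i _).mpr (pow_dvd_pow _ hs), map_zero, map_zero, map_zero]
  let σ := (Fintype.equivFin {i // n i ≠ 0}).symm
  have hσ (t) : n (σ t) - 1 + 1 = n (σ t) := Nat.sub_add_cancel (Nat.pos_of_ne_zero (σ t).2)
  -- As `n (σ t)` is positive, truncated subtraction gives the true size of the block.
  refine ⟨Fintype.card {i // n i ≠ 0}, fun t => n (σ t) - 1, fun t => v (σ t), ?_, ?_, ?_⟩
  · intro t
    exact hv0 _ (hσ t).ge
  · rw [Fintype.linearIndependent_iff]
    rintro c hc ⟨t, s⟩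
    -- The component of the relation in the summand of index `σ t` is a polynomial relation.
    let ψ : AEval' e →ₗ[K[X]] Q (σ t) := DirectSum.component K[X] (Fin m) Q (σ t) ∘ₗ g.toLinearMap
    have hψ (u) (r : ℕ) (a : K) : ψ (AEval'.of e (a • (e ^ r) (v (σ u)))) =
        if u = t then (C a * (X : K[X]) ^ r) • one (σ t) else 0 := by
      have : AEval'.of e (a • (e ^ r) (v (σ u))) = (C a : K[X]) • AEval'.of e ((e ^ r) (v (σ u))) :=
        (algebraMap_smul K[X] a _).symm
      rw [this, map_smul]
      change C a • DirectSum.component K[X] (Fin m) Q (σ t) (g (AEval'.of e _)) = _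
      rw [hgv, DirectSum.component.of]
      by_cases hut : u = t
      · subst hut
        simp [mul_smul]
      · rw [dif_neg, if_neg hut, smul_zero]
        exact fun h => hut (σ.injective (Subtype.ext h))
    have h0 := congrArg (fun x => ψ (AEval'.of e x)) hc
    simp only [map_sum, Fintype.sum_sigma, hψ, map_zero] at h0
    rw [Finset.sum_eq_single t (fun u _ hu => by simp [hu]) (by simp)] at h0
    simp only [if_true] at h0
    rw [← Finset.sum_smul, hone, X_pow_dvd_iff] at h0
    have := h0 s (by have := s.is_lt; have := hσ t; omega)
    simpa [finsetSum_coeff, coeff_X_pow, ← Fin.ext_iff] using this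
  · set S := Submodule.span K (Set.range
      (fun p : (Σ t, Fin (n (σ t) - 1 + 1)) => (e ^ (p.2 : ℕ)) (v (σ p.1))))
    have hmem (i : Fin m) (s : ℕ) : (e ^ s) (v i) ∈ S := by
      by_cases hs : n i ≤ s
      · rw [hv0 i hs]
        exact zero_mem _
      · obtain ⟨t, ht⟩ := σ.surjective ⟨i, by omega⟩
        have hi : (σ t : Fin m) = i := congrArg Subtype.val ht
        refine Submodule.subset_span ⟨⟨t, ⟨s, ?_⟩⟩, ?_⟩
        · have := hσ t
          rw [hi] at this ⊢
          omega
        · simp only [hi]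
    have hpoly (i : Fin m) (p : K[X]) : (aeval e p) (v i) ∈ S := by
      rw [aeval_eq_sum_range, LinearMap.sum_apply]
      exact Submodule.sum_mem _ fun s _ => Submodule.smul_mem _ _ (hmem i s)
    have hall (y : ⨁ i, Q i) : (AEval'.of e).symm (g.symm y) ∈ S := by
      induction y using DirectSum.induction_on with
      | zero => simp
      | of i q =>
        obtain ⟨p, rfl⟩ := Submodule.Quotient.mk_surjective _ q
        have : DirectSum.of Q i (Submodule.Quotient.mk p) =
            p • DirectSum.lof K[X] (Fin m) Q i (one i) := by
          rw [← map_smul, ← Submodule.Quotient.mk_smul, smul_eq_mul, mul_one]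
          rfl
        rw [this, map_smul]
        exact hpoly i p
      | add x y hx hy =>
        rw [map_add, map_add]
        exact add_mem hx hy
    rw [eq_top_iff]
    intro x _
    simpa using hall (g (AEval'.of e x))

end JordanExistence

/-! ### Choice of scalars and conclusion -/

/-- A field with at least `k` elements carries a family of pairwise distinct scalars that vanishes
at most at one index of minimal size. -/
theorem exists_injective_of_card_le {K : Type*} [Field K] {k : ℕ} (d : Fin k → ℕ)
    (hk : (k : Cardinal) ≤ Cardinal.mk K) :
    ∃ a : Fin k → K, Function.Injective a ∧ ∀ i j, d i < d j → a j ≠ 0 := by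
  rcases Nat.eq_zero_or_pos k with rfl | hpos
  · exact ⟨fun i => i.elim0, fun i => i.elim0, fun i => i.elim0⟩
  have : Nonempty (Fin k) := ⟨⟨0, hpos⟩⟩
  obtain ⟨f⟩ : Nonempty (Fin k ↪ K) := by
    exact Cardinal.lift_mk_le'.mp (by simpa using hk)
  obtain ⟨i₀, hi₀⟩ := Finite.exists_min d
  refine ⟨fun i => f i - f i₀, fun i j hij => f.injective (sub_left_injective hij), ?_⟩
  intro i j hij h0
  rw [f.injective (sub_eq_zero.mp h0)] at hij
  exact absurd (hi₀ i) (not_le.mpr hij)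

theorem mainTheorem1 {K V : Type*} [Field K] [AddCommGroup V] [Module K V]
    [FiniteDimensional K V] (e : Module.End K V) (he : IsNilpotent e) :
    (∃ (k : ℕ) (d : Fin k → ℕ) (w : Fin k → V), IsJordanSystem e d w) ∧
    ∀ (k : ℕ) (d : Fin k → ℕ) (w : Fin k → V) (h : IsJordanSystem e d w),
      (∀ a : Fin k → K, (∀ i, a i ≠ 0) → Function.Injective a →
        (∀ φ : glCentralizer e, φ ∈ coadjointStabilizer (h.covector a) ↔
          ∀ i, (h.block i).map (φ : Module.End K V) ≤ h.block i) ∧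
        (coadjointStabilizer (h.covector a)).toSubmodule =
          Submodule.span K (Set.range fun p : (Σ i : Fin k, Fin (d i + 1)) => h.xiDiag p.1 p.2) ∧
        Module.finrank K (coadjointStabilizer (h.covector a)) = Module.finrank K V) ∧
      ((k : Cardinal) ≤ Cardinal.mk K →
        lieIndex K (glCentralizer e) = Module.finrank K V ∧
        Module.finrank K V = LieAlgebra.rank K (Module.End K V)) := by
  refine ⟨exists_isJordanSystem he, fun k d w h => ⟨fun a ha0 ha =>
    h.stabilizer_covector ha fun _ j _ => ha0 j, fun hk => ⟨?_, (LieAlgebra.rank_end K V).symm⟩⟩⟩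
  obtain ⟨a, ha, ha0⟩ := exists_injective_of_card_le d hk
  refine le_antisymm ?_ (finrank_le_lieIndex_glCentralizer e)
  exact (ciInf_le (OrderBot.bddBelow _) (h.covector a)).trans
    (h.stabilizer_covector ha ha0).2.2.le
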